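/- **Setting.** Graphs are finite, undirected, without self-loops, with node labels $\ell:V\to\mathbb N$. For a finite set $S$ of labels let $\mathrm{enc}:\mathbb N\to\mathbb R^p$ be injective on $S$, and let $F_i=\mathrm{enc}(\ell(i))$ be the resulting node features (consistent with the labels). Fix a continuous, non-polynomial activation function $\sigma:\mathbb R\to\mathbb R$ (e.g. ReLU or GELU); feed-forward networks are compositions of affine maps and coordinatewise $\sigma$. Fix $\varepsilon>0$; layer normalization $\mathsf{LN}$ acts on each token $x\in\mathbb R^d$ by $x_k\mapsto \gamma_k\,(x_k-\mu_k)/\sqrt{v_k+\varepsilon}+\beta_k$ with learnable $\gamma,\beta$, where either $\mu_k,v_k$ are the mean and variance of the entries of $x$ itself, or $\mu_k$, $v_k\ge 0$ are fixed numbers (statistics collected during training). The statements below hold for each of these two modes, used in all layers. **Edge Transformer (ET).** A parameterization consists of $x_1,x_2\in\mathbb R^q$, a feed-forward network $\phi:\mathbb R^{q+2p}\to\mathbb R^d$ and, for each layer, matrices $W^Q,W^K,W^{V_1},W^{V_2}\in\mathbb R^{d\times d}$, parameters of $\mathsf{LN}$ and a feed-forward network $\mathsf{FFN}:\mathbb R^d\to\mathbb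 R^d$. For a graph $G$ put $X^{(0)}_{ij}=\phi([E_{ij}\;F_i\;F_j])$ with $E_{ij}=x_1$ if $ij$ is an edge, $E_{ii}=x_2$, and $E_{ij}=0$ otherwise, and $$X^{(t)}_{ij}=\mathsf{FFN}\bigl(X^{(t-1)}_{ij}+\mathsf{TriAttention}(\mathsf{LN}(X^{(t-1)}))_{ij}\bigr),\qquad \mathsf{TriAttention}(Y)_{ij}=\sum_{l}\alpha_{ilj}\,\bigl(Y_{il}W^{V_1}\odot Y_{lj}W^{V_2}\bigr),$$ where $\alpha_{ilj}$ is the softmax over $l$ of $\tfrac1{\sqrt d}\,Y_{il}W^Q(Y_{lj}W^K)^T$. **Logic.** $\mathcal C_{3,t}$ is the set of first-order formulas with counting quantifiers $\exists^{\ge m}$ over the relations edge, equality and $C_c(v)\Leftrightarrow\ell(v)=c$, that use at most the three variables $x_1,x_2,x_3$ (which may be re-quantified) and have quantifier depth at most $t$. A $2$-configuration in $G$ is a map $f:\{x_1,x_2\}\to V(G)$; it gives the node pair $\vec u=(f(x_1),f(x_2))$. **Corollary.** Let $n\ge 0$. 1. For every parameterization of the ET, every $t\ge 0$, all labelled graphs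 $G,H$ with $n$ nodes, and all pairs $\vec u\in V(G)^2$, $\vec v\in V(H)^2$ given by $2$-configurations: if $\vec u$ (in $G$) and $\vec v$ (in $H$) satisfy the same formulas of $\mathcal C_{3,t}$ whose free variables are in $\{x_1,x_2\}$, then $X^{(t)}(\vec u)=X^{(t)}(\vec v)$. 2. There is a parameterization of the ET (depending on $n$, $\sigma$, $\mathrm{enc}$, $S$, $\varepsilon$ and the mode of $\mathsf{LN}$) such that for every $t\ge0$, all labelled graphs $G,H$ with $n$ nodes and labels in $S$, and all pairs $\vec u\in V(G)^2$, $\vec v\in V(H)^2$ given by $2$-configurations: $$X^{(t)}(\vec u)=X^{(t)}(\vec v)\iff \vec u,\vec v \text{ satisfy the same formulas of }\mathcal C_{3,t}\text{ whose free variables are in }\{x_1,x_2\}.$$ -/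

import Mathlib

open scoped Matrix NNReal

namespace EdgeTransformer

/-! ### Node-labelled graphs -/

/-- A node-labelled graph on `V`: a simple undirected graph without self-loops together with a
node-label (color) function. -/
structure LabeledGraph (V : Type) where
  graph : SimpleGraph V
  label : V → ℕ

/-! ### First-order logic with counting quantifiers -/

/-- Formulas of first-order logic with counting quantifiers over node-labelled graphs, built from
the `k` variables indexed by `Fin k`, which may be re-quantified freely. Atoms: equality of nodes,
adjacency, and the color relations. `existsGE m i φ` is `∃^{≥ m} x_i, φ`; the ordinary quantifiers
and the quantifier "exactly `m`" are Boolean combinations of these of the same quantifier depth. -/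
inductive CFormula (k : ℕ) : Type
  | fls : CFormula k
  | eq (i j : Fin k) : CFormula k
  | adj (i j : Fin k) : CFormula k
  | color (c : ℕ) (i : Fin k) : CFormula k
  | neg (φ : CFormula k) : CFormula k
  | conj (φ ψ : CFormula k) : CFormula k
  | disj (φ ψ : CFormula k) : CFormula k
  | existsGE (m : ℕ) (i : Fin k) (φ : CFormula k) : CFormula k

namespace CFormula

variable {k : ℕ}

/-- Quantifier depth. -/
def qdepth : CFormula k → ℕ
  | fls => 0
  | eq _ _ => 0
  | adj _ _ => 0
  | color _ _ => 0
  | neg φ => φ.qdepth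
  | conj φ ψ => max φ.qdepth ψ.qdepth
  | disj φ ψ => max φ.qdepth ψ.qdepth
  | existsGE _ _ φ => φ.qdepth + 1

/-- The set of free variables. -/
def freeVars : CFormula k → Finset (Fin k)
  | fls => ∅
  | eq i j => {i, j}
  | adj i j => {i, j}
  | color _ i => {i}
  | neg φ => φ.freeVars
  | conj φ ψ => φ.freeVars ∪ ψ.freeVars
  | disj φ ψ => φ.freeVars ∪ ψ.freeVars
  | existsGE _ i φ => φ.freeVars.erase i

/-- Satisfaction of a formula in `G` under an assignment `a` of all `k` variables. -/
def Sat {V : Type} (G : LabeledGraph V) : CFormula k → (Fin k → V) → Prop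
  | fls, _ => False
  | eq i j, a => a i = a j
  | adj i j, a => G.graph.Adj (a i) (a j)
  | color c i, a => G.label (a i) = c
  | neg φ, a => ¬ φ.Sat G a
  | conj φ ψ, a => φ.Sat G a ∧ ψ.Sat G a
  | disj φ ψ, a => φ.Sat G a ∨ ψ.Sat G a
  | existsGE m i φ, a => (m : ℕ∞) ≤ {w : V | φ.Sat G (Function.update a i w)}.encard

/-- Satisfaction depends only on the values of the free variables. -/
theorem sat_congr {V : Type} (G : LabeledGraph V) (φ : CFormula k) (a b : Fin k → V)
    (h : ∀ i ∈ φ.freeVars, a i = b i) : φ.Sat G a ↔ φ.Sat G b := by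
  induction φ generalizing a b with
  | fls => simp [Sat]
  | eq i j => simp [Sat, h i (by simp [freeVars]), h j (by simp [freeVars])]
  | adj i j => simp [Sat, h i (by simp [freeVars]), h j (by simp [freeVars])]
  | color c i => simp [Sat, h i (by simp [freeVars])]
  | neg φ ih => simp only [Sat]; rw [ih a b h]
  | conj φ ψ ih1 ih2 =>
    simp only [Sat]
    rw [ih1 a b fun i hi => h i (by simp [freeVars, hi]),
      ih2 a b fun i hi => h i (by simp [freeVars, hi])]
  | disj φ ψ ih1 ih2 =>
    simp only [Sat]
    rw [ih1 a b fun i hi => h i (by simp [freeVars, hi]),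
      ih2 a b fun i hi => h i (by simp [freeVars, hi])]
  | existsGE m i φ ih =>
    have key : ∀ w : V, φ.Sat G (Function.update a i w) ↔ φ.Sat G (Function.update b i w) := by
      intro w
      refine ih _ _ fun j hj => ?_
      by_cases hji : j = i
      · subst hji; simp
      · simp only [Function.update_of_ne hji]
        exact h j (by simp [freeVars, hji, hj])
    simp only [Sat, key]

end CFormula

/-- A 2-configuration: an assignment of nodes to the variables `x₁, x₂` (indices `0, 1`). -/
abbrev Config2 (V : Type) := Fin 2 → V

/-- `G, f ⊨ φ` for a 2-configuration `f` and a formula `φ` in three variables whose free variables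
are among `x₁, x₂`. The value given to `x₃` is irrelevant by `CFormula.sat_congr`. -/
def Models {V : Type} (G : LabeledGraph V) (f : Config2 V) (φ : CFormula 3) : Prop :=
  φ.Sat G ![f 0, f 1, f 0]

/-- `f` (in `G`) and `g` (in `H`) satisfy the same formulas of `C_{3,t}` (counting logic with three
variables and quantifier depth at most `t`) whose free variables are among `x₁, x₂`. -/
def SameC3 {V W : Type} (t : ℕ) (G : LabeledGraph V) (f : Config2 V)
    (H : LabeledGraph W) (g : Config2 W) : Prop :=
  ∀ φ : CFormula 3, φ.qdepth ≤ t → φ.freeVars ⊆ {0, 1} → (Models G f φ ↔ Models H g φ)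

/-! ### Neural networks -/

/-- Weights of a feed-forward neural network `ℝ^a → ℝ^b` of arbitrary depth and hidden widths. -/
inductive FFN : ℕ → ℕ → Type
  | out {a b : ℕ} (W : Matrix (Fin a) (Fin b) ℝ) (bias : Fin b → ℝ) : FFN a b
  | hidden {a b h : ℕ} (W : Matrix (Fin a) (Fin h) ℝ) (bias : Fin h → ℝ) (rest : FFN h b) : FFN a b

/-- The function computed by a network with activation function `σ` (vectors are row vectors):
each hidden layer is `x ↦ σ(x W + bias)`, the output layer is `x ↦ x W + bias`. -/
def FFN.eval (σ : ℝ → ℝ) : {a b : ℕ} → FFN a b → (Fin a → ℝ) → (Fin b → ℝ)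
  | _, _, .out W bias, x => x ᵥ* W + bias
  | _, _, .hidden W bias rest, x => rest.eval σ fun k => σ ((x ᵥ* W + bias) k)

/-- The two ways in which layer normalization can be evaluated: with the statistics of the token
at hand, or with fixed statistics collected during training. -/
inductive NormMode
  | token
  | frozen

/-- Parameters of a layer normalization; `mean` and `var` are the statistics collected during
training and are used in mode `frozen` only. -/
structure NormParams (d : ℕ) where
  gain : Fin d → ℝ
  bias : Fin d → ℝ
  mean : Fin d → ℝ
  var : Fin d → ℝ≥0

/-- Layer normalization of a token `x ∈ ℝ^d` with stabilizer `ε`. -/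
noncomputable def layerNorm (mode : NormMode) (ε : ℝ) {d : ℕ} (θ : NormParams d)
    (x : Fin d → ℝ) : Fin d → ℝ :=
  match mode with
  | .token =>
    let μ : ℝ := (∑ k, x k) / d
    let v : ℝ := (∑ k, (x k - μ) ^ 2) / d
    fun k => θ.gain k * ((x k - μ) / Real.sqrt (v + ε)) + θ.bias k
  | .frozen =>
    fun k => θ.gain k * ((x k - θ.mean k) / Real.sqrt (θ.var k + ε)) + θ.bias k

/-! ### The Edge Transformer -/

/-- Softmax over a finite index set. -/
noncomputable def softmax {ι : Type} [Fintype ι] (s : ι → ℝ) (l : ι) : ℝ :=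
  Real.exp (s l) / ∑ l', Real.exp (s l')

/-- Projection matrices of triangular attention. -/
structure AttnParams (d : ℕ) where
  WQ : Matrix (Fin d) (Fin d) ℝ
  WK : Matrix (Fin d) (Fin d) ℝ
  WV₁ : Matrix (Fin d) (Fin d) ℝ
  WV₂ : Matrix (Fin d) (Fin d) ℝ

section
variable {V : Type} [Fintype V] {d : ℕ}

/-- Attention score `α_{ilj}`: softmax over `l` of `(X_{il} W^Q) (X_{lj} W^K)ᵀ / √d`. -/
noncomputable def attnScore (A : AttnParams d) (X : V → V → Fin d → ℝ) (i l j : V) : ℝ :=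
  softmax (fun l' => 1 / Real.sqrt d * ((X i l' ᵥ* A.WQ) ⬝ᵥ (X l' j ᵥ* A.WK))) l

/-- Value fusion `V_{ilj} = X_{il} W^{V₁} ⊙ X_{lj} W^{V₂}`. -/
def valueFusion (A : AttnParams d) (X : V → V → Fin d → ℝ) (i l j : V) : Fin d → ℝ :=
  (X i l ᵥ* A.WV₁) * (X l j ᵥ* A.WV₂)

/-- Triangular attention `∑_l α_{ilj} V_{ilj}`. -/
noncomputable def triAttention (A : AttnParams d) (X : V → V → Fin d → ℝ) (i j : V) :
    Fin d → ℝ :=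
  ∑ l, attnScore A X i l j • valueFusion A X i l j

/-- Parameters of one Edge Transformer layer. -/
structure LayerParams (d : ℕ) where
  norm : NormParams d
  attn : AttnParams d
  ffn : FFN d d

/-- One Edge Transformer layer: `X_{ij} ↦ FFN (X_{ij} + TriAttention (LN X)_{ij})`. -/
noncomputable def layer (σ : ℝ → ℝ) (mode : NormMode) (ε : ℝ) (L : LayerParams d)
    (X : V → V → Fin d → ℝ) (i j : V) : Fin d → ℝ :=
  L.ffn.eval σ (X i j + triAttention L.attn (fun a b => layerNorm mode ε L.norm (X a b)) i j)

end

/-- A parameterization of the Edge Transformer for node features in `ℝ^p`, edge features in `ℝ^q`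
and embedding dimension `d`: the vectors encoding edges and diagonal pairs, the token network `φ`,
and the parameters of the layers (`layers s` belongs to layer number `s + 1`). -/
structure Params (p q d : ℕ) where
  x₁ : Fin q → ℝ
  x₂ : Fin q → ℝ
  φ : FFN (q + p + p) d
  layers : ℕ → LayerParams d

section
variable {V : Type} {p q d : ℕ}

open Classical in
/-- The edge feature tensor. -/
noncomputable def edgeFeature (P : Params p q d) (G : LabeledGraph V) (i j : V) : Fin q → ℝ :=
  if G.graph.Adj i j then P.x₁ else if i = j then P.x₂ else 0

/-- The node feature matrix `F_i = enc (ℓ i)` given by an encoding `enc` of the labels. It is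
consistent with the labels as soon as `enc` is injective on them. -/
def nodeFeature (enc : ℕ → Fin p → ℝ) (G : LabeledGraph V) (i : V) : Fin p → ℝ :=
  enc (G.label i)

/-- The input tokens `φ [E_{ij}, F_i, F_j]`. -/
noncomputable def tokens (σ : ℝ → ℝ) (enc : ℕ → Fin p → ℝ) (P : Params p q d)
    (G : LabeledGraph V) (i j : V) : Fin d → ℝ :=
  P.φ.eval σ
    (Fin.append (Fin.append (edgeFeature P G i j) (nodeFeature enc G i)) (nodeFeature enc G j))

/-- The embeddings `X^{(t)}_{ij}` after `t` layers. -/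
noncomputable def embedding [Fintype V] (σ : ℝ → ℝ) (mode : NormMode) (ε : ℝ)
    (enc : ℕ → Fin p → ℝ) (P : Params p q d) (G : LabeledGraph V) : ℕ → V → V → Fin d → ℝ
  | 0 => tokens σ enc P G
  | t + 1 => layer σ mode ε (P.layers t) (embedding σ mode ε enc P G t)

end

end EdgeTransformer

/-! Both sides of the corollary are compared with `PairEquiv`, the colouring of node pairs by t
rounds of folklore two-dimensional Weisfeiler–Leman.

Logic: depth-t equivalence in three variables is exactly `PairEquiv` t. The bijections of nodes
transport the witnesses of a counting quantifier (`PairEquiv.sat_iff`); conversely, on finite graphs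
each class of candidate values for the third variable is definable, so counting it yields a
bijection (`PairEquiv.of_sat_iff`).

Upper bound: a layer reads only X_ij and the multiset of pairs (X_il, X_lj), so a reindexing of l
leaves it unchanged (`PairEquiv.embedding_eq`).

Lower bound: only finitely many labelled graphs on n nodes have labels in S. Colours are kept as
standard basis vectors. Layer normalization can fix these, uniform attention counts pairs of
colours, and the feed-forward network recodes the finitely many outcomes as basis vectors
(`exists_layer_refining`). The recoding is exact because a continuous non-polynomial activation
interpolates on finite sets (`FFN.exists_eval_eq`). -/

namespace EdgeTransformer

/-! ### Folklore Weisfeiler–Leman and three-variable counting logic -/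

/-- Two maps with equinumerous fibres differ by a bijection of their domains. -/
theorem exists_equiv_of_ncard_fiber_eq {α β γ : Type*} [Finite α] [Finite β]
    (f : α → γ) (g : β → γ) (h : ∀ c, {a | f a = c}.ncard = {b | g b = c}.ncard) :
    ∃ π : α ≃ β, ∀ a, g (π a) = f a := by
  have e : ∀ c, Nonempty ({a // f a = c} ≃ {b // g b = c}) := fun c =>
    (Finite.card_eq (α := {a // f a = c})).1 (h c)
  exact ⟨Equiv.ofFiberEquiv fun c => (e c).some, fun a => Equiv.ofFiberEquiv_map _ a⟩

/-- Equality of pair colors after `t` rounds of the folklore two-dimensional Weisfeiler–Leman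
algorithm. -/
def PairEquiv {V W : Type} (G : LabeledGraph V) (H : LabeledGraph W) :
    ℕ → V → V → W → W → Prop
  | 0, u, v, u', v' => (G.graph.Adj u v ↔ H.graph.Adj u' v') ∧ (u = v ↔ u' = v') ∧
      G.label u = H.label u' ∧ G.label v = H.label v'
  | t + 1, u, v, u', v' => PairEquiv G H t u v u' v' ∧
      ∃ π : V ≃ W, ∀ l, PairEquiv G H t u l u' (π l) ∧ PairEquiv G H t l v (π l) v'

section
variable {V W : Type} {G : LabeledGraph V} {H : LabeledGraph W}

theorem PairEquiv.mono {s t : ℕ} (hst : s ≤ t) {u v : V} {u' v' : W}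
    (h : PairEquiv G H t u v u' v') : PairEquiv G H s u v u' v' := by
  induction hst with
  | refl => exact h
  | step _ ih => exact ih h.1

theorem PairEquiv.symm {t : ℕ} {u v : V} {u' v' : W} (h : PairEquiv G H t u v u' v') :
    PairEquiv G H t v u v' u' := by
  induction t generalizing u v u' v' with
  | zero =>
    obtain ⟨h1, h2, h3, h4⟩ := h
    exact ⟨by rw [G.graph.adj_comm, h1, H.graph.adj_comm], by rw [eq_comm, h2, eq_comm], h4, h3⟩
  | succ t ih =>
    obtain ⟨h1, π, h2⟩ := h
    exact ⟨ih h1, π, fun l => ⟨ih (h2 l).2, ih (h2 l).1⟩⟩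

theorem PairEquiv.diag {t : ℕ} {u v : V} {u' v' : W} (h : PairEquiv G H t u v u' v') :
    PairEquiv G H t u u u' u' := by
  induction t with
  | zero =>
    obtain ⟨h1, h2, h3, h4⟩ := h
    exact ⟨by simp, by simp, h3, h3⟩
  | succ t ih =>
    obtain ⟨h1, π, h2⟩ := h
    exact ⟨ih h1, π, fun l => ⟨(h2 l).1, (h2 l).1.symm⟩⟩

/-- Pairwise equivalence suffices because re-quantifying one variable leaves two values in place,
and the bijection attached to that pair matches the new value with both. -/
theorem PairEquiv.sat_iff (φ : CFormula 3) {t : ℕ} (hφ : φ.qdepth ≤ t)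
    {a : Fin 3 → V} {b : Fin 3 → W} (h : ∀ i j, PairEquiv G H t (a i) (a j) (b i) (b j)) :
    φ.Sat G a ↔ φ.Sat H b := by
  induction φ generalizing t a b with
  | fls => rfl
  | eq i j => exact ((h i j).mono (Nat.zero_le t)).2.1
  | adj i j => exact ((h i j).mono (Nat.zero_le t)).1
  | color c i => simp only [CFormula.Sat, ((h i i).mono (Nat.zero_le t)).2.2.1]
  | neg φ ih => exact not_congr (ih hφ h)
  | conj φ ψ ih1 ih2 =>
    exact and_congr (ih1 ((le_max_left _ _).trans hφ) h) (ih2 ((le_max_right _ _).trans hφ) h)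
  | disj φ ψ ih1 ih2 =>
    exact or_congr (ih1 ((le_max_left _ _).trans hφ) h) (ih2 ((le_max_right _ _).trans hφ) h)
  | existsGE m k φ ih =>
    obtain _ | t := t
    · simp [CFormula.qdepth] at hφ
    have hφ' : φ.qdepth ≤ t := by simpa [CFormula.qdepth] using hφ
    obtain ⟨i, j, hij⟩ : ∃ i j : Fin 3, ∀ l, l = i ∨ l = j ∨ l = k := by
      clear hφ; revert k; decide
    obtain ⟨-, π, hπ⟩ := h i j
    have key : ∀ w, φ.Sat G (Function.update a k w) ↔
        φ.Sat H (Function.update b k (π w)) := by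
      intro w
      have hk : ∀ l, l ≠ k → PairEquiv G H t (a l) w (b l) (π w) := by
        intro l hl
        rcases hij l with rfl | rfl | rfl
        · exact (hπ w).1
        · exact (hπ w).2.symm
        · exact absurd rfl hl
      refine ih hφ' fun r s => ?_
      by_cases hr : r = k <;> by_cases hs : s = k
      · subst hr; subst hs; simpa using (hπ w).1.symm.diag
      · subst hr; simpa [hs] using (hk s hs).symm
      · subst hs; simpa [hr] using hk r hr
      · simpa [hr, hs] using (h r s).1
    simp only [CFormula.Sat]
    have himg : π '' {w | φ.Sat G (Function.update a k w)} =
        {w | φ.Sat H (Function.update b k w)} := by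
      ext w
      simp only [Set.mem_image, Set.mem_ofPred_eq, key]
      exact ⟨fun ⟨x, hx, hw⟩ => hw ▸ hx, fun hw => ⟨π.symm w, by simpa using hw, by simp⟩⟩
    rw [← himg, π.injective.encard_image]

theorem PairEquiv.sameC3 {t : ℕ} {f : Config2 V} {g : Config2 W}
    (h : PairEquiv G H t (f 0) (f 1) (g 0) (g 1)) : SameC3 t G f H g := by
  intro φ hφ _
  refine PairEquiv.sat_iff φ hφ fun i j => ?_
  -- As x₃ takes the value of x₁, each pair of values is the given pair, its reverse or a diagonal
  -- pair.
  fin_cases i <;> fin_cases j <;>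
    first | exact h | exact h.symm | exact h.diag | exact h.symm.diag

/-- A class of points of a finite type, each point outside of which is told apart from it by a
formula of depth at most `t` with free variables in `s`, is defined by such a formula. -/
theorem exists_formula_sat_iff {k : ℕ} {ι : Type*} [Finite ι] (s : Finset (Fin k)) (t : ℕ)
    (sat : CFormula k → ι → Prop)
    (hneg : ∀ φ x, sat φ.neg x ↔ ¬ sat φ x) (hfls : ∀ x, ¬ sat .fls x)
    (hconj : ∀ φ ψ x, sat (φ.conj ψ) x ↔ sat φ x ∧ sat ψ x) (P : ι → Prop)
    (hP : ∀ y, ¬ P y → ∃ φ : CFormula k, φ.qdepth ≤ t ∧ φ.freeVars ⊆ s ∧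
      ∀ x, P x → (sat φ x ↔ ¬ sat φ y)) :
    ∃ χ : CFormula k, χ.qdepth ≤ t ∧ χ.freeVars ⊆ s ∧ ∀ y, sat χ y ↔ P y := by
  classical
  have := Fintype.ofFinite ι
  -- The formula is a conjunction of separating formulas, one for each point of A outside the class.
  suffices h : ∀ A : Finset ι, ∃ χ : CFormula k, χ.qdepth ≤ t ∧ χ.freeVars ⊆ s ∧
      (∀ y, P y → sat χ y) ∧ ∀ y ∈ A, sat χ y → P y by
    obtain ⟨χ, h1, h2, h3, h4⟩ := h Finset.univ
    exact ⟨χ, h1, h2, fun y => ⟨h4 y (Finset.mem_univ y), h3 y⟩⟩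
  intro A
  induction A using Finset.induction_on with
  | empty => exact ⟨.neg .fls, by simp [CFormula.qdepth], by simp [CFormula.freeVars],
      fun y _ => (hneg _ _).2 (hfls y), by simp⟩
  | insert y A _ ih =>
    obtain ⟨χ, h1, h2, h3, h4⟩ := ih
    by_cases hy : P y
    · refine ⟨χ, h1, h2, h3, fun z hz => ?_⟩
      rcases Finset.mem_insert.1 hz with rfl | hz
      exacts [fun _ => hy, h4 z hz]
    obtain ⟨φ, p1, p2, p3, p4⟩ : ∃ φ : CFormula k, φ.qdepth ≤ t ∧ φ.freeVars ⊆ s ∧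
        (∀ x, P x → sat φ x) ∧ ¬ sat φ y := by
      obtain ⟨φ, p1, p2, p3⟩ := hP y hy
      by_cases hφ : sat φ y
      · exact ⟨φ.neg, p1, p2, fun x hx => (hneg _ _).2 fun h => (p3 x hx).1 h hφ,
          fun h => (hneg _ _).1 h hφ⟩
      · exact ⟨φ, p1, p2, fun x hx => (p3 x hx).2 hφ, hφ⟩
    refine ⟨χ.conj φ, max_le h1 p1, Finset.union_subset h2 p2,
      fun x hx => (hconj _ _ _).2 ⟨h3 x hx, p3 x hx⟩, fun z hz hsat => ?_⟩
    obtain ⟨q1, q2⟩ := (hconj _ _ _).1 hsat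
    rcases Finset.mem_insert.1 hz with rfl | hz
    exacts [absurd q2 p4, h4 z hz q1]

/-- Candidates for the third variable are sorted by their types over the two fixed nodes. A formula
defining a type, put under `existsGE`, costs one more quantifier and shows that the type occurs
equally often in both graphs. -/
theorem PairEquiv.of_sat_iff [Finite V] [Finite W] {t : ℕ} {i j : Fin 3} (hij : i ≠ j)
    {a : Fin 3 → V} {b : Fin 3 → W}
    (h : ∀ φ : CFormula 3, φ.qdepth ≤ t → φ.freeVars ⊆ {i, j} → (φ.Sat G a ↔ φ.Sat H b)) :
    PairEquiv G H t (a i) (a j) (b i) (b j) := by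
  induction t generalizing i j a b with
  | zero =>
    refine ⟨h (.adj i j) le_rfl subset_rfl, h (.eq i j) le_rfl subset_rfl, ?_, ?_⟩
    · exact ((h (.color (G.label (a i)) i) le_rfl (by simp [CFormula.freeVars])).1 rfl).symm
    · exact ((h (.color (G.label (a j)) j) le_rfl (by simp [CFormula.freeVars])).1 rfl).symm
  | succ t ih =>
    refine ⟨ih hij fun φ hφ => h φ (hφ.trans t.le_succ), ?_⟩
    obtain ⟨k, hki, hkj, hk⟩ : ∃ k : Fin 3, k ≠ i ∧ k ≠ j ∧ ({i, j, k} : Finset (Fin 3)).erase k ⊆ {i, j} := by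
      clear h; revert i j; decide
    -- Only formulas about one of the pairs (i, k), (k, j) enter a type, as the induction hypothesis
    -- concerns pairs. Both kinds are recorded together, so that a single bijection serves both
    -- pairs.
    let ok : CFormula 3 → Prop := fun φ =>
      φ.qdepth ≤ t ∧ (φ.freeVars ⊆ {i, k} ∨ φ.freeVars ⊆ {k, j})
    let sat : CFormula 3 → V ⊕ W → Prop := fun φ =>
      Sum.elim (fun v => φ.Sat G (Function.update a k v)) fun w => φ.Sat H (Function.update b k w)
    let type : V ⊕ W → Set (CFormula 3) := fun x => {φ | ok φ ∧ sat φ x}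
    have hok : ∀ φ, ok φ → φ.freeVars ⊆ {i, j, k} := by
      rintro φ ⟨-, hφ | hφ⟩ x hx <;> have := hφ hx <;> simp at this ⊢ <;> tauto
    have hsat : ∀ {x y}, type x = type y → ∀ φ, ok φ → (sat φ x ↔ sat φ y) := by
      intro x y hxy φ hφ
      have : φ ∈ type x ↔ φ ∈ type y := by rw [hxy]
      simpa [type, hφ] using this
    have card : ∀ c, {v : V | type (.inl v) = c}.ncard = {w : W | type (.inr w) = c}.ncard := by
      intro c
      obtain ⟨χ, h1, h2, h3⟩ := exists_formula_sat_iff {i, j, k} t sat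
        (by rintro φ (x | x) <;> rfl) (by rintro (x | x) <;> exact id)
        (by rintro φ ψ (x | x) <;> rfl) (fun y => type y = c) (by
          intro y hy
          by_cases hc : ∃ x, type x = c
          · obtain ⟨x, rfl⟩ := hc
            by_contra! hcon
            refine hy (Set.ext fun φ => and_congr_right fun hφ => ?_)
            obtain ⟨z, hz, hz'⟩ := hcon φ hφ.1 (hok φ hφ)
            rw [← hsat hz φ hφ]
            tauto
          -- A type that no node realizes imposes no condition on the separating formula.
          · exact ⟨.fls, Nat.zero_le t, Finset.empty_subset _, fun x hx => absurd ⟨x, hx⟩ hc⟩)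
      have hχ : ∀ m : ℕ, _ ↔ _ := fun m => h (.existsGE m k χ) (Nat.succ_le_succ h1)
        ((Finset.erase_subset_erase k h2).trans hk)
      have e1 : {v : V | type (.inl v) = c} = {v | χ.Sat G (Function.update a k v)} :=
        Set.ext fun v => (h3 (.inl v)).symm
      have e2 : {w : W | type (.inr w) = c} = {w | χ.Sat H (Function.update b k w)} :=
        Set.ext fun w => (h3 (.inr w)).symm
      rw [Set.ncard_def, Set.ncard_def, e1, e2]
      congr 1
      exact le_antisymm (ENat.forall_natCast_le_iff_le.1 fun m => (hχ m).1)
        (ENat.forall_natCast_le_iff_le.1 fun m => (hχ m).2)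
    obtain ⟨π, hπ⟩ := exists_equiv_of_ncard_fiber_eq _ _ card
    refine ⟨π, fun l => ⟨?_, ?_⟩⟩
    · have := ih (i := i) (j := k) hki.symm (a := Function.update a k l)
        (b := Function.update b k (π l)) fun φ hφ hv => (hsat (hπ l) φ ⟨hφ, .inl hv⟩).symm
      simpa [hki.symm] using this
    · have := ih (i := k) (j := j) hkj (a := Function.update a k l)
        (b := Function.update b k (π l)) fun φ hφ hv => (hsat (hπ l) φ ⟨hφ, .inr hv⟩).symm
      simpa [hkj.symm] using this

theorem SameC3.pairEquiv [Finite V] [Finite W] {t : ℕ} {f : Config2 V} {g : Config2 W}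
    (h : SameC3 t G f H g) : PairEquiv G H t (f 0) (f 1) (g 0) (g 1) :=
  PairEquiv.of_sat_iff (i := 0) (j := 1) (a := ![f 0, f 1, f 0]) (b := ![g 0, g 1, g 0])
    (by decide) h

end

/-! ### Upper bound: invariance of the embeddings -/

theorem PairEquiv.embedding_eq {V W : Type} [Fintype V] [Fintype W] {G : LabeledGraph V}
    {H : LabeledGraph W} (σ : ℝ → ℝ) (mode : NormMode) (ε : ℝ) {p q d : ℕ}
    (enc : ℕ → Fin p → ℝ) (P : Params p q d) {t : ℕ} {u v : V} {u' v' : W}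
    (h : PairEquiv G H t u v u' v') :
    embedding σ mode ε enc P G t u v = embedding σ mode ε enc P H t u' v' := by
  induction t generalizing u v u' v' with
  | zero =>
    obtain ⟨h1, h2, h3, h4⟩ := h
    simp only [embedding, tokens, edgeFeature, nodeFeature, h3, h4]
    congr 3
    by_cases ha : H.graph.Adj u' v' <;> by_cases he : u' = v' <;> simp [h1, h2, ha, he]
  | succ t ih =>
    obtain ⟨h1, π, h2⟩ := h
    simp only [embedding, layer, triAttention, attnScore, valueFusion, softmax]
    rw [ih h1]
    congr 2
    refine Fintype.sum_equiv π _ _ fun l => ?_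
    rw [ih (h2 l).1, ih (h2 l).2]
    congr 2
    refine Fintype.sum_equiv π _ _ fun l => ?_
    rw [ih (h2 l).1, ih (h2 l).2]

end EdgeTransformer

/-! ### Finite interpolation with a non-polynomial activation -/

namespace EdgeTransformer

open Filter Topology MeasureTheory Convolution ContDiff

theorem exists_sum_pow_of_iteratedDeriv_eq_zero (k : ℕ) (g : ℝ → ℝ) (hg : ContDiff ℝ ∞ g)
    (h : ∀ x, iteratedDeriv k g x = 0) :
    ∃ a : ℕ → ℝ, ∀ x, g x = ∑ m ∈ Finset.range k, a m * x ^ m := by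
  induction k generalizing g with
  | zero => exact ⟨0, by simpa using h⟩
  | succ k ih =>
    have hd : Differentiable ℝ g := hg.differentiable (by simp)
    obtain ⟨a, ha⟩ := ih (deriv g) (contDiff_infty_iff_deriv.1 hg).2 fun x => by
      rw [← h x, iteratedDeriv_succ']
    let F : ℝ → ℝ := fun x => ∑ m ∈ Finset.range k, a m / (m + 1) * x ^ (m + 1)
    have hF : ∀ x, HasDerivAt F (deriv g x) x := by
      intro x
      rw [ha x]
      refine HasDerivAt.fun_sum fun m _ => ?_
      have := (hasDerivAt_pow (m + 1) x).const_mul (a m / (m + 1))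
      refine this.congr_deriv ?_
      have : (m : ℝ) + 1 ≠ 0 := by positivity
      rw [Nat.add_sub_cancel, ← mul_assoc, Nat.cast_add_one, div_mul_cancel₀ _ this]
    have hconst : ∀ x, g x - F x = g 0 - F 0 := fun x =>
      is_const_of_deriv_eq_zero (f := fun x => g x - F x)
        (fun y => (hd y).sub (hF y).differentiableAt)
        (fun y => ((hd y).hasDerivAt.fun_sub (hF y)).deriv.trans (sub_self _)) x 0
    refine ⟨fun m => if m = 0 then g 0 - F 0 else a (m - 1) / ((m - 1 : ℕ) + 1), fun x => ?_⟩
    rw [Finset.sum_range_succ']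
    simp only [Nat.add_eq_zero_iff, one_ne_zero, and_false, if_false, Nat.add_sub_cancel, if_true,
      pow_zero, mul_one]
    linarith [hconst x]

/-- Pointwise limits of polynomials of bounded degree are polynomials. -/
theorem exists_polynomial_of_tendsto {ι : Type*} {l : Filter ι} [l.NeBot] (k : ℕ)
    (g : ι → ℝ → ℝ) (f : ℝ → ℝ) (hlim : ∀ x, Tendsto (fun i => g i x) l (𝓝 (f x)))
    (hg : ∀ i, ∃ a : ℕ → ℝ, ∀ x, g i x = ∑ m ∈ Finset.range k, a m * x ^ m) :
    ∃ Q : Polynomial ℝ, ∀ x, f x = Q.eval x := by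
  -- Interpolation at the fixed nodes 0, …, k - 1 depends on finitely many values only, so it
  -- commutes with pointwise limits.
  let I : (ℝ → ℝ) → Polynomial ℝ := fun u =>
    Lagrange.interpolate (Finset.range k) (fun i : ℕ => (i : ℝ)) fun i => u i
  have hI : ∀ i x, g i x = (I (g i)).eval x := by
    intro i x
    obtain ⟨a, ha⟩ := hg i
    let Q : Polynomial ℝ := ∑ m ∈ Finset.range k, Polynomial.C (a m) * Polynomial.X ^ m
    have hQ : ∀ y, g i y = Q.eval y := fun y => by simp [Q, ha, Polynomial.eval_finsetSum]
    have hdeg : Q.degree < (Finset.range k).card := by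
      rw [← Polynomial.mem_degreeLT]
      refine Submodule.sum_mem _ fun m hm => Polynomial.mem_degreeLT.2 ?_
      refine (Polynomial.degree_C_mul_X_pow_le _ _).trans_lt ?_
      simpa using hm
    have := Lagrange.eq_interpolate (v := fun i : ℕ => (i : ℝ)) Nat.cast_injective.injOn hdeg
    rw [hQ, this]
    simp only [I, ← hQ]
  refine ⟨I f, fun x => tendsto_nhds_unique (hlim x) ?_⟩
  refine Tendsto.congr (fun i => (hI i x).symm) ?_
  simp only [I, Lagrange.interpolate_apply, Polynomial.eval_finsetSum, Polynomial.eval_mul,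
    Polynomial.eval_C]
  exact tendsto_finsetSum _ fun m _ => (hlim m).mul_const _

/-- The dilates and translates of a continuous function that is not a polynomial are linearly
independent at distinct points. -/
theorem eq_zero_of_sum_mul_comp_affine_eq_zero {σ : ℝ → ℝ} (hσ : Continuous σ)
    (hσ_poly : ¬ ∃ Q : Polynomial ℝ, ∀ x : ℝ, σ x = Q.eval x) {N : ℕ} {t c : Fin N → ℝ}
    (ht : Function.Injective t) (h : ∀ s b, ∑ i, c i * σ (s * t i + b) = 0) : c = 0 := by
  by_contra hc
  -- By the Vandermonde determinant, a nonzero c has a nonzero moment against the distinct t.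
  obtain ⟨k, hk⟩ : ∃ k : Fin N, ∑ j, c j * t j ^ (k : ℕ) ≠ 0 := by
    by_contra! hcon
    exact hc (Matrix.eq_zero_of_forall_pow_sum_mul_pow_eq_zero ht hcon)
  let φ : ℕ → ContDiffBump (0 : ℝ) := fun m =>
    { rIn := 1 / (m + 1 : ℝ) / 2, rOut := 1 / (m + 1 : ℝ), rIn_pos := by positivity
      rIn_lt_rOut := half_lt_self (by positivity) }
  -- The mollifications of σ inherit the linear relation and may be differentiated. The k-th
  -- derivative in s at 0 is the nonzero moment times the k-th derivative of g m at b. So each g m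
  -- is a polynomial of degree below k, a bound independent of m, and so is the limit σ.
  let g : ℕ → ℝ → ℝ := fun m => (φ m).normed volume ⋆[ContinuousLinearMap.lsmul ℝ ℝ, volume] σ
  refine hσ_poly (exists_polynomial_of_tendsto (l := atTop) k g σ (fun x => ?_) fun m => ?_)
  · exact ContDiffBump.convolution_tendsto_right_of_continuous
      tendsto_one_div_add_atTop_nhds_zero_nat hσ x
  have hsmooth : ContDiff ℝ ∞ (g m) :=
    (φ m).hasCompactSupport_normed.contDiff_convolution_left _ (φ m).contDiff_normed
      hσ.locallyIntegrable
  refine exists_sum_pow_of_iteratedDeriv_eq_zero k (g m) hsmooth fun b => ?_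
  have hsum : ∀ s, ∑ i, c i * g m (t i * s + b) = 0 := by
    intro s
    have hint : ∀ i, Integrable fun y => c i * ((φ m).normed volume y * σ (t i * s + b - y)) := by
      intro i
      refine Integrable.const_mul (Continuous.integrable_of_hasCompactSupport ?_ ?_) _
      · exact (φ m).continuous_normed.mul (by fun_prop)
      · exact (φ m).hasCompactSupport_normed.mul_right
    calc ∑ i, c i * g m (t i * s + b)
        = ∑ i, ∫ y, c i * ((φ m).normed volume y * σ (t i * s + b - y)) := by
          simp only [integral_const_mul]; rfl
      _ = ∫ y, ∑ i, c i * ((φ m).normed volume y * σ (t i * s + b - y)) :=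
          (integral_finsetSum _ fun i _ => hint i).symm
      _ = ∫ y, (φ m).normed volume y * ∑ i, c i * σ (s * t i + (b - y)) := by
          refine integral_congr_ae (.of_forall fun y => ?_)
          simp only [Finset.mul_sum]
          refine Finset.sum_congr rfl fun i _ => ?_
          rw [mul_comm s, add_sub_assoc]
          ring
      _ = 0 := by simp [h]
  have hder : iteratedDeriv k (fun s => ∑ i, c i * g m (t i * s + b)) 0 =
      (∑ i, c i * t i ^ (k : ℕ)) * iteratedDeriv k (g m) b := by
    have hs : ContDiff ℝ (k : ℕ) fun y => g m (y + b) :=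
      (hsmooth.comp (contDiff_id.add contDiff_const)).of_le (by exact_mod_cast le_top)
    rw [iteratedDeriv_fun_sum fun i _ => ?_, Finset.sum_mul]
    · refine Finset.sum_congr rfl fun i _ => ?_
      rw [iteratedDeriv_const_mul_field, iteratedDeriv_comp_const_mul hs (t i),
        iteratedDeriv_comp_add_const]
      simp [mul_assoc]
    · exact (contDiff_const.mul (hs.comp (contDiff_const.mul contDiff_id))).contDiffAt
  have hzero : iteratedDeriv k (fun s => ∑ i, c i * g m (t i * s + b)) 0 = 0 := by
    simp [hsum]
  exact (mul_eq_zero.1 (hder.symm.trans hzero)).resolve_left hk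

/-- Networks with one hidden layer interpolate arbitrary values at finitely many points. -/
theorem FFN.exists_eval_eq {σ : ℝ → ℝ} (hσ : Continuous σ)
    (hσ_poly : ¬ ∃ Q : Polynomial ℝ, ∀ x : ℝ, σ x = Q.eval x) {a b : ℕ}
    (s : Finset (Fin a → ℝ)) (y : (Fin a → ℝ) → Fin b → ℝ) :
    ∃ F : FFN a b, ∀ x ∈ s, F.eval σ x = y x := by
  let p : Fin s.card → Fin a → ℝ := fun i => s.equivFin.symm i
  have hp : Function.Injective p := Subtype.val_injective.comp s.equivFin.symm.injective
  -- A generic direction separates the sample points, which reduces the problem to one real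
  -- variable.
  obtain ⟨w, hw⟩ : ∃ w : Fin a → ℝ, Function.Injective fun i => p i ⬝ᵥ w := by
    obtain ⟨f, hf⟩ := Module.exists_dual_forall_apply_ne_zero (K := ℝ)
      (fun ij : {ij : Fin s.card × Fin s.card // ij.1 ≠ ij.2} => p ij.1.1 - p ij.1.2)
      fun ij => sub_ne_zero.2 (hp.ne ij.2)
    have hdot : ∀ x, x ⬝ᵥ (fun k => f fun j => if k = j then 1 else 0) = f x :=
      fun x => (LinearMap.pi_apply_eq_sum_univ f x).symm
    refine ⟨fun k => f fun j => if k = j then 1 else 0, fun i j hij => ?_⟩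
    by_contra hne
    refine hf ⟨(i, j), hne⟩ ?_
    simp only [hdot] at hij
    simpa [sub_eq_zero] using hij
  let v : ℝ × ℝ → Fin s.card → ℝ := fun r i => σ (r.1 * (p i ⬝ᵥ w) + r.2)
  -- A proper span would lie in the kernel of a nonzero functional, whose coefficients give a
  -- forbidden linear relation.
  have hspan : ⊤ ≤ Submodule.span ℝ (Set.range v) := by
    by_contra hcon
    obtain ⟨f, hf0, hf⟩ := Submodule.exists_le_ker_of_lt_top _ (lt_top_iff_ne_top.2 fun h => hcon h.ge)
    let c : Fin s.card → ℝ := fun i => f fun j => if i = j then 1 else 0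
    have hexp : ∀ u, f u = ∑ i, c i * u i := fun u =>
      (LinearMap.pi_apply_eq_sum_univ f u).trans
        (Finset.sum_congr rfl fun i _ => by rw [smul_eq_mul, mul_comm])
    have hc : c = 0 := eq_zero_of_sum_mul_comp_affine_eq_zero hσ hσ_poly hw fun r b => by
      rw [← hexp (v (r, b))]
      exact hf (Submodule.subset_span ⟨_, rfl⟩)
    exact hf0 (LinearMap.ext fun u => by rw [hexp, hc]; simp)
  obtain ⟨ι, _, B, hB⟩ : ∃ (ι : Type) (_ : Fintype ι) (B : Module.Basis ι ℝ (Fin s.card → ℝ)),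
      ∀ m, B m ∈ Set.range v :=
    ⟨_, FiniteDimensional.fintypeBasisIndex (Module.Basis.ofSpan hspan), Module.Basis.ofSpan hspan,
      fun m => Module.Basis.ofSpan_subset hspan ⟨m, rfl⟩⟩
  let e := (Fintype.equivFin ι).symm
  choose r hr using fun m => hB (e m)
  -- Each hidden unit realizes one basis vector of the sample space; the output weights are the
  -- coordinates of the target values.
  refine ⟨.hidden (.of fun k m => (r m).1 * w k) (fun m => (r m).2)
    (.out (.of fun m j => B.repr (fun i => y (p i) j) (e m)) 0), fun x hx => funext fun j => ?_⟩
  obtain ⟨i, rfl⟩ : ∃ i, p i = x := ⟨s.equivFin ⟨x, hx⟩, by simp [p]⟩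
  have hhid : ∀ m, σ ((p i ᵥ* Matrix.of (fun k m => (r m).1 * w k) + fun m => (r m).2) m) =
      B (e m) i := by
    intro m
    rw [← hr m]
    simp only [v, Pi.add_apply, Matrix.vecMul, dotProduct, Matrix.of_apply, Finset.mul_sum]
    congr 2
    exact Finset.sum_congr rfl fun k _ => by ring
  simp only [FFN.eval, hhid, add_zero]
  have hrepr := congrFun (B.sum_repr fun i => y (p i) j) i
  rw [← e.sum_comp] at hrepr
  simp only [Finset.sum_apply, Pi.smul_apply, smul_eq_mul] at hrepr
  rw [← hrepr]
  simp only [Matrix.vecMul, dotProduct, Matrix.of_apply, mul_comm]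

end EdgeTransformer

/-! ### Lower bound: simulating the refinement by layers -/

namespace EdgeTransformer

/-- In both modes, one and the same layer normalization can fix all standard basis vectors. -/
theorem exists_layerNorm_single_eq (mode : NormMode) {ε : ℝ} (hε : 0 < ε) (d : ℕ) :
    ∃ θ : NormParams d, ∀ k : Fin d,
      layerNorm mode ε θ (Pi.single k 1) = Pi.single k 1 := by
  cases mode with
  | token =>
    -- All standard basis vectors have the same mean and variance, so one gain and one bias undo the
    -- normalization of all of them.
    let μ : ℝ := 1 / d
    let v : ℝ := (1 - 2 * μ + d * μ ^ 2) / d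
    have hsum : ∀ k : Fin d, ∑ i, (Pi.single k 1 : Fin d → ℝ) i = 1 := fun k => by simp
    have hv : ∀ k : Fin d, (∑ i, ((Pi.single k 1 : Fin d → ℝ) i - μ) ^ 2) / d = v := by
      intro k
      have hsq : ∀ i, ((Pi.single k 1 : Fin d → ℝ) i - μ) ^ 2 =
          (Pi.single k 1 : Fin d → ℝ) i * (1 - 2 * μ) + μ ^ 2 := by
        intro i
        by_cases hi : i = k
        · subst hi; simp; ring
        · simp [hi]
      simp only [hsq, Finset.sum_add_distrib, ← Finset.sum_mul, hsum]
      simp [v]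
    refine ⟨⟨fun _ => √(v + ε), fun _ => μ, 0, 0⟩, fun k => funext fun i => ?_⟩
    have hpos : √(v + ε) ≠ 0 := by
      have : 0 ≤ v := hv k ▸ by positivity
      positivity
    simp only [layerNorm, hsum]
    rw [hv, mul_div_cancel₀ _ hpos]
    ring
  | frozen =>
    refine ⟨⟨fun _ => √ε, 0, 0, 0⟩, fun k => funext fun i => ?_⟩
    have hpos : √ε ≠ 0 := by positivity
    simp [layerNorm, mul_div_cancel₀ _ hpos]

/-- Triangular attention with uniform scores can count, for all pairs of colors, the nodes `l` such
that `(i, l)` and `(l, j)` have these colors, if the colors are encoded as standard basis vectors. -/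
theorem exists_triAttention_eq_ncard {K V : Type} [Fintype V] {d : ℕ} [Finite K]
    (e : K ⊕ K × K ≃ Fin d) :
    ∃ A : AttnParams d, ∀ (c : V → V → K) (i j : V) (x : K ⊕ K × K),
      triAttention A (fun u v => Pi.single (e (.inl (c u v))) 1) i j (e x) =
        x.elim (fun _ => 0) fun ab => (Fintype.card V : ℝ)⁻¹ * {l | (c i l, c l j) = ab}.ncard := by
  classical
  have := Fintype.ofFinite K
  -- A colour is sent to the indicator of the pairs with that component, so the entrywise product of
  -- the two values marks a single pair. The colour block of the output stays zero, free for the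
  -- residual term.
  let W (π : K × K → K) : Matrix (Fin d) (Fin d) ℝ := .of fun r s =>
    match e.symm r, e.symm s with
    | .inl a, .inr ab => if π ab = a then 1 else 0
    | _, _ => 0
  refine ⟨⟨0, 0, W Prod.fst, W Prod.snd⟩, fun c i j x => ?_⟩
  simp only [triAttention, attnScore, softmax, valueFusion, Matrix.vecMul_zero, dotProduct_zero,
    mul_zero, Real.exp_zero]
  simp only [Finset.sum_apply, Pi.smul_apply, Pi.mul_apply, Matrix.single_one_vecMul, Matrix.row, smul_eq_mul]
  rcases x with x | ⟨a, b⟩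
  · simp [W]
  · have hcount : ({l | (c i l, c l j) = (a, b)}.ncard : ℝ) =
        ∑ l, if b = c l j then if a = c i l then 1 else 0 else 0 := by
      rw [Set.ncard_eq_toFinset_card', Finset.card_eq_sum_ones, Nat.cast_sum, Set.toFinset_ofPred,
        Finset.sum_filter]
      refine Finset.sum_congr rfl fun l _ => ?_
      by_cases h1 : c i l = a <;> by_cases h2 : c l j = b <;> simp [h1, h2, Ne.symm]
    rw [Sum.elim_inr, hcount, Finset.mul_sum]
    simp [W]

/-- A representative in `α` of the fibre of `D` through `x`. -/
noncomputable def fiberRep {α β : Type*} (D : α → β) (x : α) : α :=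
  (Quotient.mk (Setoid.ker D) x).out

theorem fiberRep_eq_iff {α β : Type*} {D : α → β} {x y : α} :
    fiberRep D x = fiberRep D y ↔ D x = D y := by
  rw [fiberRep, fiberRep, Quotient.out_inj, Quotient.eq]
  rfl

/-- The residual sum holds the old colour in one block and the scaled pair counts in the other, and
hence determines one full refinement round. The layer is common to all graphs of the finite family.
-/
theorem exists_layer_refining {σ : ℝ → ℝ} (hσ : Continuous σ)
    (hσ_poly : ¬ ∃ Q : Polynomial ℝ, ∀ x : ℝ, σ x = Q.eval x) (mode : NormMode) {ε : ℝ}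
    (hε : 0 < ε) {Γ V : Type} [Finite Γ] [Fintype V] {d : ℕ}
    (e : (Γ × V × V) ⊕ (Γ × V × V) × (Γ × V × V) ≃ Fin d) (c : Γ × V × V → Γ × V × V) :
    ∃ (L : LayerParams d) (c' : Γ × V × V → Γ × V × V),
      (∀ γ u v, layer σ mode ε L (fun i j => Pi.single (e (.inl (c (γ, i, j)))) 1) u v =
        Pi.single (e (.inl (c' (γ, u, v)))) 1) ∧
      ∀ γ u v γ' u' v', c' (γ, u, v) = c' (γ', u', v') → c (γ, u, v) = c (γ', u', v') ∧
        ∃ π : V ≃ V, ∀ l, c (γ, u, l) = c (γ', u', π l) ∧ c (γ, l, v) = c (γ', π l, v') := by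
  classical
  obtain ⟨θ, hθ⟩ := exists_layerNorm_single_eq mode hε d
  obtain ⟨A, hA⟩ := exists_triAttention_eq_ncard (V := V) e
  let X : Γ → V → V → Fin d → ℝ := fun γ i j => Pi.single (e (.inl (c (γ, i, j)))) 1
  let D : Γ × V × V → Fin d → ℝ := fun τ => X τ.1 τ.2.1 τ.2.2 + triAttention A (X τ.1) τ.2.1 τ.2.2
  -- Naming new colours by representatives keeps them in the same finite type, so the width d never
  -- grows.
  let c' := fiberRep D
  have := Fintype.ofFinite Γ
  let Y : Γ × V × V → Fin d → ℝ := fun τ => Pi.single (e (.inl (c' τ))) 1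
  have hY : ∀ τ τ', D τ = D τ' → Y τ = Y τ' := fun τ τ' h => by
    simp only [Y, c', fiberRep_eq_iff.2 h]
  obtain ⟨F, hF⟩ := FFN.exists_eval_eq hσ hσ_poly (Finset.univ.image D) (Function.extend D Y 0)
  refine ⟨⟨θ, A, F⟩, c', fun γ u v => ?_, fun γ u v γ' u' v' h => ?_⟩
  · simp only [layer, hθ]
    have h1 := hF (D (γ, u, v)) (by simp)
    rw [Function.FactorsThrough.extend_apply (fun τ τ' h => hY τ τ' h)] at h1
    exact h1
  · have hD := fiberRep_eq_iff.1 h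
    have hval : ∀ γ u v x, D (γ, u, v) (e x) =
        x.elim (fun a => if a = c (γ, u, v) then 1 else 0) fun ab =>
          (Fintype.card V : ℝ)⁻¹ * {l | (c (γ, u, l), c (γ, l, v)) = ab}.ncard := by
      intro γ u v x
      simp only [D, X, Pi.add_apply, hA (fun i j => c (γ, i, j))]
      rcases x with x | x <;> simp [Pi.single_apply]
    have hn : (Fintype.card V : ℝ) ≠ 0 := by
      have : Nonempty V := ⟨u⟩
      simp
    constructor
    · have := congrFun hD (e (.inl (c (γ, u, v))))
      simp only [hval, Sum.elim_inl, if_true] at this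
      by_contra hne
      simp [hne] at this
    · obtain ⟨π, hπ⟩ := exists_equiv_of_ncard_fiber_eq
        (fun l => (c (γ, u, l), c (γ, l, v))) (fun l => (c (γ', u', l), c (γ', l, v'))) fun ab => by
          have := congrFun hD (e (.inr ab))
          simp only [hval, Sum.elim_inr] at this
          exact_mod_cast mul_left_cancel₀ (inv_ne_zero hn) this
      exact ⟨π, fun l => ⟨(Prod.ext_iff.1 (hπ l)).1.symm, (Prod.ext_iff.1 (hπ l)).2.symm⟩⟩

theorem append_inj {α : Type*} {m n : ℕ} {a a' : Fin m → α} {b b' : Fin n → α}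
    (h : Fin.append a b = Fin.append a' b') : a = a' ∧ b = b' :=
  ⟨funext fun i => by simpa using congrFun h (Fin.castAdd n i),
    funext fun i => by simpa using congrFun h (Fin.natAdd m i)⟩

open Classical in
theorem iff_and_iff_of_ite_eq {A E A' E' : Prop} (h : A → ¬ E) (h' : A' → ¬ E')
    (heq : (if A then (1 : ℝ) else if E then 2 else 0) = if A' then 1 else if E' then 2 else 0) :
    (A ↔ A') ∧ (E ↔ E') := by
  by_cases hA : A <;> by_cases hE : E <;> by_cases hA' : A' <;> by_cases hE' : E' <;>
    simp_all

/-- For every finite family of labelled graphs with finite label set on the same nodes there are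
Edge Transformer parameters whose embeddings are at least as fine as the colorings of the folklore
Weisfeiler–Leman algorithm. -/
theorem exists_params_pairEquiv_of_embedding_eq {σ : ℝ → ℝ} (hσ : Continuous σ)
    (hσ_poly : ¬ ∃ Q : Polynomial ℝ, ∀ x : ℝ, σ x = Q.eval x) (mode : NormMode) {ε : ℝ}
    (hε : 0 < ε) {p : ℕ} {S : Set ℕ} {enc : ℕ → Fin p → ℝ}
    (henc : Set.InjOn enc S) {Γ V : Type} [Finite Γ] [Fintype V] (Gr : Γ → LabeledGraph V)
    (hS : ∀ γ i, (Gr γ).label i ∈ S) :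
    ∃ (q d : ℕ) (P : Params p q d), ∀ (t : ℕ) (γ γ' : Γ) (u v u' v' : V),
      embedding σ mode ε enc P (Gr γ) t u v = embedding σ mode ε enc P (Gr γ') t u' v' →
        PairEquiv (Gr γ) (Gr γ') t u v u' v' := by
  classical
  have := Fintype.ofFinite Γ
  let e := Fintype.equivFin ((Γ × V × V) ⊕ (Γ × V × V) × (Γ × V × V))
  choose L next hL hnext using exists_layer_refining hσ hσ_poly mode hε e
  -- The values 1, 2, 0 tell edges, diagonal pairs and other pairs apart.
  let edge (γ : Γ) (u v : V) : Fin 1 → ℝ := fun _ =>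
    if (Gr γ).graph.Adj u v then 1 else if u = v then 2 else 0
  let D : Γ × V × V → Fin (1 + p + p) → ℝ := fun τ =>
    Fin.append (Fin.append (edge τ.1 τ.2.1 τ.2.2) (nodeFeature enc (Gr τ.1) τ.2.1))
      (nodeFeature enc (Gr τ.1) τ.2.2)
  let Y : Γ × V × V → Fin _ → ℝ := fun τ => Pi.single (e (.inl (fiberRep D τ))) 1
  have hY : Y.FactorsThrough D := fun τ τ' h => by simp only [Y, fiberRep_eq_iff.2 h]
  obtain ⟨F, hF⟩ := FFN.exists_eval_eq hσ hσ_poly (Finset.univ.image D) (Function.extend D Y 0)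
  have hFD : ∀ τ, F.eval σ (D τ) = Y τ := fun τ => by
    rw [hF (D τ) (by simp), hY.extend_apply]
  -- The colouring of the whole family determines the next layer, so the layers depend on no
  -- individual graph and serve every t.
  let color : ℕ → Γ × V × V → Γ × V × V := fun t => t.rec (fiberRep D) fun _ c => next c
  let P : Params p 1 _ := ⟨1, 2, F, fun t => L (color t)⟩
  have hcolor : ∀ t γ, embedding σ mode ε enc P (Gr γ) t =
      fun u v => Pi.single (e (.inl (color t (γ, u, v)))) 1 := by
    intro t γ
    induction t with
    | zero =>
      funext u v
      refine Eq.trans ?_ (hFD (γ, u, v))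
      have hedge : edgeFeature P (Gr γ) u v = edge γ u v := by
        funext i
        simp only [edgeFeature, P, edge]
        split_ifs <;> rfl
      simp only [embedding, tokens, D, hedge, P]
    | succ t ih =>
      funext u v
      simp only [embedding, ih]
      exact hL (color t) γ u v
  refine ⟨1, _, P, fun t γ γ' u v u' v' h => ?_⟩
  have hc : color t (γ, u, v) = color t (γ', u', v') := by
    simp only [hcolor] at h
    have h1 := congrFun h (e (.inl (color t (γ, u, v))))
    by_contra hne
    simp [hne] at h1
  clear h
  induction t generalizing u v u' v' with
  | zero =>
    have hD : D (γ, u, v) = D (γ', u', v') := fiberRep_eq_iff.1 hc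
    obtain ⟨h12, h3⟩ := append_inj hD
    obtain ⟨h1, h2⟩ := append_inj h12
    obtain ⟨ha, he⟩ := iff_and_iff_of_ite_eq (fun h => h.ne) (fun h => h.ne) (congrFun h1 0)
    exact ⟨ha, he, henc (hS _ _) (hS _ _) h2, henc (hS _ _) (hS _ _) h3⟩
  | succ t ih =>
    obtain ⟨h1, π, h2⟩ := hnext (color t) γ u v γ' u' v' hc
    exact ⟨ih _ _ _ _ h1, π, fun l => ⟨ih _ _ _ _ (h2 l).1, ih _ _ _ _ (h2 l).2⟩⟩

end EdgeTransformer

theorem mainTheorem2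
    (σ : ℝ → ℝ) (hσ : Continuous σ)
    (hσ_poly : ¬ ∃ Q : Polynomial ℝ, ∀ x : ℝ, σ x = Q.eval x)
    (mode : EdgeTransformer.NormMode) (ε : ℝ) (hε : 0 < ε)
    (n p : ℕ) (S : Finset ℕ) (enc : ℕ → Fin p → ℝ) (henc : Set.InjOn enc (S : Set ℕ)) :
    (∀ (q d : ℕ) (P : EdgeTransformer.Params p q d) (t : ℕ)
      (G H : EdgeTransformer.LabeledGraph (Fin n))
      (f g : EdgeTransformer.Config2 (Fin n)),
      EdgeTransformer.SameC3 t G f H g →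
        EdgeTransformer.embedding σ mode ε enc P G t (f 0) (f 1) =
          EdgeTransformer.embedding σ mode ε enc P H t (g 0) (g 1)) ∧
    (∃ (q d : ℕ) (P : EdgeTransformer.Params p q d), ∀ (t : ℕ)
      (G H : EdgeTransformer.LabeledGraph (Fin n)),
      (∀ i, G.label i ∈ S) → (∀ i, H.label i ∈ S) →
      ∀ f g : EdgeTransformer.Config2 (Fin n),
        EdgeTransformer.embedding σ mode ε enc P G t (f 0) (f 1) =
            EdgeTransformer.embedding σ mode ε enc P H t (g 0) (g 1) ↔
          EdgeTransformer.SameC3 t G f H g) := by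
  
  refine ⟨fun q d P t G H f g h => h.pairEquiv.embedding_eq σ mode ε enc P, ?_⟩
  obtain ⟨q, d, P, hP⟩ := EdgeTransformer.exists_params_pairEquiv_of_embedding_eq hσ hσ_poly mode hε henc
    -- This family is finite because S is, and contains both G and H.
    (fun γ : SimpleGraph (Fin n) × (Fin n → S) => ⟨γ.1, fun i => γ.2 i⟩) fun γ i => (γ.2 i).2
  refine ⟨q, d, P, fun t G H hG hH f g => ⟨fun h => ?_, fun h =>
    h.pairEquiv.embedding_eq σ mode ε enc P⟩⟩
  exact (hP t (G.graph, fun i => ⟨G.label i, hG i⟩) (H.graph, fun i => ⟨H.label i, hH i⟩)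
    _ _ _ _ h).sameC3
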